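/- **Setting.** Let $(\Omega,\mathcal F,(\mathcal F_t)_{t\ge 0},\mathbb Q)$ be a filtered probability space carrying a standard $(\mathcal F_t)$-Brownian motion $Z$ (a Brownian motion with continuous paths a.s., adapted, with $Z_t-Z_s$ independent of $\mathcal F_s$ for $s\le t$). Let $H\in(0,1)$ (the rough case is $H<\tfrac12$), $\nu>0$, $H_+:=H+\tfrac12$ and $$C_H:=\sqrt{\frac{2H\,\Gamma(2-H_+)}{\Gamma(H_+)\,\Gamma(2-2H)}}.$$ Let $\xi_0(t)$, $t\ge 0$, be strictly positive, $\mathcal F_0$-measurable, integrable random variables (the initial forward variance curve). For $0\le T\le t$ put $$\mathcal V_t^T:=\int_0^T (t-u)^{H-\frac12}\,\mathrm dZ_u,\qquad \mathcal V_t:=\mathcal V^t_t,\qquad \eta_T(t):=\exp\left(2\nu C_H\mathcal V_t^T\right),$$ the integrals being Wiener–Itô integrals of deterministic functions. In the rough Bergomi model the instantaneous variance is $V_t=\xi_0(t)\,\mathcal E(2\nu C_H\mathcal V_t)$ almost surely, for each $t\ge 0$, where the stochastic exponential is $$\mathcal E(c\,\mathcal V_t):=\exp\left(c\,\mathcal V_t-\frac{c^2}{2}\int_0^t\left((t-u)^{H-\frac12}\right)^2\mathrm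 du\right),$$ that is, the Doléans-Dade exponential at time $t$ of the martingale $s\mapsto c\int_0^s(t-u)^{H-\frac12}\,\mathrm dZ_u$, $s\le t$. For $0\le T\le t$ the forward variance observed at time $T$ for the maturity $t$ is $\xi_T(t):=\mathbb E[V_t\mid\mathcal F_T]$, and for $T<t$ the fair strike at time $T$ of a variance swap maturing at $t$ is $\sigma_T^2(t):=\mathbb E\big[\tfrac1{t-T}\int_T^tV_u\,\mathrm du\,\big|\,\mathcal F_T\big]$. **Proposition.** (1) For all $0\le T\le t$, $V_t$ is integrable and, almost surely, $$\xi_T(t)=\xi_0(t)\,\eta_T(t)\,\exp\left(\frac{\nu^2C_H^2}{H}\left[(t-T)^{2H}-t^{2H}\right]\right).$$ (2) The same expression is the forward variance curve of the variance swaps: suppose that $(t,\omega)\mapsto V_t(\omega)$ is jointly measurable, let $T\ge0$, and let $(\bar\xi_T(t))_{t\ge 0}$ be a family, measurable with respect to $\mathcal B([0,\infty))\otimes\mathcal F_T$, such that for each $t\ge T$ the variable $\bar\xi_T(t)$ is almost surely equal to the right-hand side of the formula in (1). Then for every $t>T$ such that $u\mapsto\mathbb E[\xi_0(u)]$ is integrable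 on $[T,t]$, the process $V$ is integrable on $[T,t]\times\Omega$ with respect to $\mathrm du\otimes\mathbb Q$, and $$\sigma_T^2(t)=\frac1{t-T}\int_T^t\bar\xi_T(u)\,\mathrm du\qquad\text{almost surely.}$$ -/

import Mathlib

open MeasureTheory ProbabilityTheory Filter Topology
open scoped NNReal ENNReal

namespace RoughBergomi

noncomputable section

variable {Ω : Type*} {mΩ : MeasurableSpace Ω}

/-- `Z` is a standard Brownian motion with respect to the filtration `F`: it is a standard
Brownian motion, it is adapted to `F`, and `Z t - Z s` is independent of `F s` for `s ≤ t`. -/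
structure IsFilteredBrownian (Z : ℝ≥0 → Ω → ℝ) (F : Filtration ℝ≥0 mΩ) (μ : Measure Ω) :
    Prop where
  isBrownian : IsBrownianReal Z μ
  adapted : ∀ t, Measurable[F t] (Z t)
  indep : ∀ s t, s ≤ t →
    Indep (MeasurableSpace.comap (fun ω => Z t ω - Z s ω) inferInstance) (F s) μ

/-- Data of a deterministic step function `∑ i, coef i * 1_{(left i, right i]}` on the half-line;
the intervals are allowed to overlap. -/
structure StepFunction where
  n : ℕ
  coef : Fin n → ℝ
  left : Fin n → ℝ≥0
  right : Fin n → ℝ≥0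
  left_le_right : ∀ i, left i ≤ right i

/-- The step function as a function of time. -/
def StepFunction.toFun (φ : StepFunction) (u : ℝ) : ℝ :=
  ∑ i, (Set.Ioc (φ.left i : ℝ) (φ.right i : ℝ)).indicator (fun _ => φ.coef i) u

/-- The elementary stochastic integral of a step function,
`∑ i, coef i * (Z (right i) - Z (left i))`. -/
def StepFunction.integral (φ : StepFunction) (Z : ℝ≥0 → Ω → ℝ) (ω : Ω) : ℝ :=
  ∑ i, φ.coef i * (Z (φ.right i) ω - Z (φ.left i) ω)

/-- `I` is a version of the stochastic (Wiener–Itô) integral `∫_a^b f(u) dZ_u` of the deterministic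
integrand `f`: there are step functions converging to `1_{(a, b]} f` in `L²(du)` whose elementary
integrals converge to `I` in `L²(μ)`. -/
def IsWienerIntegral (μ : Measure Ω) (Z : ℝ≥0 → Ω → ℝ) (f : ℝ → ℝ) (a b : ℝ≥0) (I : Ω → ℝ) :
    Prop :=
  MemLp I 2 μ ∧ ∃ φ : ℕ → StepFunction,
    Tendsto (fun n => eLpNorm
      (fun u => (Set.Ioc (a : ℝ) (b : ℝ)).indicator f u - (φ n).toFun u) 2 volume)
      atTop (𝓝 0) ∧
    Tendsto (fun n => eLpNorm (fun ω => I ω - (φ n).integral Z ω) 2 μ) atTop (𝓝 0)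

open Classical in
/-- The stochastic integral `∫_a^b f(u) dZ_u` of a deterministic integrand, as a random variable
(a chosen version of the `L²`-limit; `0` if there is none, which does not happen when `Z` is a
Brownian motion and `f` is square-integrable on `(a, b]`). -/
def wienerIntegral (μ : Measure Ω) (Z : ℝ≥0 → Ω → ℝ) (f : ℝ → ℝ) (a b : ℝ≥0) : Ω → ℝ :=
  if h : ∃ I, IsWienerIntegral μ Z f a b I then h.choose else 0

/-- The constant `C_H = √(2 H Γ(2 - H₊) / (Γ(H₊) Γ(2 - 2 H)))` with `H₊ = H + 1/2`. -/
def cH (H : ℝ) : ℝ :=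
  √(2 * H * Real.Gamma (2 - (H + 1 / 2)) / (Real.Gamma (H + 1 / 2) * Real.Gamma (2 - 2 * H)))

/-- The kernel `u ↦ (t - u)^{H - 1/2}`. -/
def kernel (H : ℝ) (t : ℝ≥0) (u : ℝ) : ℝ := ((t : ℝ) - u) ^ (H - 1 / 2)

/-- `∫_0^T (t - u)^{H - 1/2} dZ_u`, for `T ≤ t`. -/
def truncatedVolterra (μ : Measure Ω) (Z : ℝ≥0 → Ω → ℝ) (H : ℝ) (T t : ℝ≥0) : Ω → ℝ :=
  wienerIntegral μ Z (kernel H t) 0 T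

/-- The Volterra process `∫_0^t (t - u)^{H - 1/2} dZ_u`. -/
def volterra (μ : Measure Ω) (Z : ℝ≥0 → Ω → ℝ) (H : ℝ) (t : ℝ≥0) : Ω → ℝ :=
  truncatedVolterra μ Z H t t

/-- The bracket `∫_0^t ((t - u)^{H - 1/2})² du`: the quadratic variation at time `t` of the
martingale `s ↦ ∫_0^s (t - u)^{H - 1/2} dZ_u`, whose value at time `t` is `volterra`. -/
def volterraBracket (H : ℝ) (t : ℝ≥0) : ℝ :=
  ∫ u in (0 : ℝ)..t, kernel H t u ^ 2

/-- The Doléans-Dade exponential of `c` times the Volterra process at time `t`: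
`exp (c 𝒱_t - (c² / 2) [𝒱]_t)`. -/
def stochasticExp (μ : Measure Ω) (Z : ℝ≥0 → Ω → ℝ) (H c : ℝ) (t : ℝ≥0) (ω : Ω) : ℝ :=
  Real.exp (c * volterra μ Z H t ω - c ^ 2 / 2 * volterraBracket H t)

/-- `V` is (a version of) the instantaneous variance process of the rough Bergomi model,
`V_t = ξ₀(t) ℰ(2 ν C_H 𝒱_t)`. -/
def IsInstantaneousVariance (μ : Measure Ω) (Z : ℝ≥0 → Ω → ℝ) (H ν : ℝ) (ξ₀ V : ℝ≥0 → Ω → ℝ) :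
    Prop :=
  ∀ t, V t =ᵐ[μ] fun ω => ξ₀ t ω * stochasticExp μ Z H (2 * ν * cH H) t ω

/-- The forward variance `ξ_T(t)` observed at time `T` for the maturity `t`: the conditional
expectation given `F T` of the instantaneous variance at time `t`. -/
def forwardVariance (μ : Measure Ω) (F : Filtration ℝ≥0 mΩ) (V : ℝ≥0 → Ω → ℝ) (T t : ℝ≥0) :
    Ω → ℝ :=
  μ[V t | F T]

/-- The fair strike, at time `T`, of a variance swap maturing at `t`: the conditional expectation
given `F T` of the realised variance `(t - T)⁻¹ ∫_T^t V_u du`. -/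
def varianceSwapStrike (μ : Measure Ω) (F : Filtration ℝ≥0 mΩ) (V : ℝ≥0 → Ω → ℝ) (T t : ℝ≥0) :
    Ω → ℝ :=
  μ[fun ω => ((t : ℝ) - T)⁻¹ * ∫ u in (T : ℝ)..t, V u.toNNReal ω | F T]

/-- `η_T(t) = exp (2 ν C_H ∫_0^T (t - u)^{H - 1/2} dZ_u)`. -/
def eta (μ : Measure Ω) (Z : ℝ≥0 → Ω → ℝ) (H ν : ℝ) (T t : ℝ≥0) (ω : Ω) : ℝ :=
  Real.exp (2 * ν * cH H * truncatedVolterra μ Z H T t ω)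

end

end RoughBergomi

/-! Split the Volterra integral at time `T`: it is the sum of `X = ∫_0^T (t - u)^{H - 1/2} dZ_u`,
known at time `T`, and of `W = ∫_T^t (t - u)^{H - 1/2} dZ_u`, a centred Gaussian variable of
variance `(t - T)^{2H} / (2H)` independent of `F T`. With `c = 2 ν C_H`, conditioning keeps `ξ₀(t)
exp (c X)` and replaces `exp (c W)` by its mean, the exponential of `c² / 2` times that variance
(`condExp_mul_exp`). Together with the compensator, where the bracket is `t^{2H} / (2H)`, this is
the stated formula.

The substance is to obtain these facts for integrals defined as `L²` limits. The covariance `min s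
t` gives the Itô isometry on step functions, hence uniqueness of the limit and, by completeness, its
existence. For approximants on partitions of `(a, b]`, the characteristic function on an event of `F
a` factorizes one increment at a time; the limit gives the law and the independence together
(`exists_isWienerIntegral`). Uniqueness and `IsWienerIntegral.add_adjacent` carry the splitting over
to the chosen versions.

For variance swaps, Fubini on events of `F T` exchanges conditioning with integration over
maturities. It applies because the integrands are almost surely nonnegative with mean `E[ξ₀(u)]`. -/

namespace RoughBergomi

variable {Ω : Type*} {mΩ : MeasurableSpace Ω} {μ : Measure Ω} {Z : ℝ≥0 → Ω → ℝ}
  {F : Filtration ℝ≥0 mΩ}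

/-! ### Linear structure and square integrability of elementary integrals -/

namespace StepFunction

/-- The sum of two step functions. -/
def add (φ ψ : StepFunction) : StepFunction where
  n := φ.n + ψ.n
  coef := Fin.append φ.coef ψ.coef
  left := Fin.append φ.left ψ.left
  right := Fin.append φ.right ψ.right
  left_le_right i := by
    refine Fin.addCases (fun i => ?_) (fun i => ?_) i
    · simpa using φ.left_le_right i
    · simpa using ψ.left_le_right i

/-- The opposite of a step function. -/
def neg (φ : StepFunction) : StepFunction where
  n := φ.n
  coef := fun i => -φ.coef i
  left := φ.left
  right := φ.right
  left_le_right := φ.left_le_right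

lemma toFun_add (φ ψ : StepFunction) (u : ℝ) : (φ.add ψ).toFun u = φ.toFun u + ψ.toFun u := by
  exact (Fin.sum_univ_add _).trans (by simp [toFun, add])

lemma integral_add (φ ψ : StepFunction) (Z : ℝ≥0 → Ω → ℝ) (ω : Ω) :
    (φ.add ψ).integral Z ω = φ.integral Z ω + ψ.integral Z ω := by
  exact (Fin.sum_univ_add _).trans (by simp [integral, add])

lemma toFun_neg (φ : StepFunction) (u : ℝ) : φ.neg.toFun u = -φ.toFun u := by
  refine Eq.trans (Finset.sum_congr rfl fun i _ => ?_) (Finset.sum_neg_distrib _)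
  exact congrFun (Set.indicator_neg _ _) u

lemma integral_neg (φ : StepFunction) (Z : ℝ≥0 → Ω → ℝ) (ω : Ω) :
    φ.neg.integral Z ω = -φ.integral Z ω := by
  refine Eq.trans (Finset.sum_congr rfl fun i _ => ?_) (Finset.sum_neg_distrib _)
  exact neg_mul _ _

lemma memLp_toFun (φ : StepFunction) (p : ℝ≥0∞) : MemLp φ.toFun p volume := by
  refine memLp_finsetSum (μ := volume) Finset.univ fun i _ => ?_
  exact memLp_indicator_const p measurableSet_Ioc _ (Or.inr (by simp))

lemma memLp_integral (hZ : IsPreBrownianReal Z μ) (φ : StepFunction) :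
    MemLp (φ.integral Z) 2 μ := by
  refine memLp_finsetSum Finset.univ fun i _ => ?_
  exact (((hZ.isGaussianProcess.hasGaussianLaw_eval _).memLp_two).sub
    (hZ.isGaussianProcess.hasGaussianLaw_eval _).memLp_two).const_mul _

end StepFunction

/-! ### The Itô isometry for step functions -/

lemma integral_eval_mul_eval (hZ : IsPreBrownianReal Z μ) (s t : ℝ≥0) :
    ∫ ω, Z s ω * Z t ω ∂μ = min (s : ℝ) t := by
  have := hZ.isGaussianProcess.isProbabilityMeasure
  have h := hZ.covariance_eval s t
  rw [covariance_eq_sub (hZ.isGaussianProcess.hasGaussianLaw_eval _).memLp_two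
    (hZ.isGaussianProcess.hasGaussianLaw_eval _).memLp_two, hZ.integral_eval] at h
  simpa using h

lemma integral_increment_mul_increment (hZ : IsPreBrownianReal Z μ) {a b c d : ℝ≥0}
    (hab : a ≤ b) (hcd : c ≤ d) :
    ∫ ω, (Z b ω - Z a ω) * (Z d ω - Z c ω) ∂μ
      = volume.real (Set.Ioc (a : ℝ) b ∩ Set.Ioc (c : ℝ) d) := by
  have hi : ∀ s t, Integrable (fun ω => Z s ω * Z t ω) μ := fun s t =>
    (hZ.isGaussianProcess.hasGaussianLaw_eval s).memLp_two.integrable_mul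
      (hZ.isGaussianProcess.hasGaussianLaw_eval t).memLp_two
  have h : ∀ ω, (Z b ω - Z a ω) * (Z d ω - Z c ω)
      = Z b ω * Z d ω - Z b ω * Z c ω - (Z a ω * Z d ω - Z a ω * Z c ω) := fun ω => by ring
  simp_rw [h]
  rw [integral_sub (by exact (hi _ _).sub (hi _ _)) (by exact (hi _ _).sub (hi _ _)),
    integral_sub (hi _ _) (hi _ _), integral_sub (hi _ _) (hi _ _)]
  simp only [integral_eval_mul_eval hZ]
  rw [Set.Ioc_inter_Ioc, Real.volume_real_Ioc]
  have h1 : (a : ℝ) ≤ b := by exact_mod_cast hab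
  have h2 : (c : ℝ) ≤ d := by exact_mod_cast hcd
  grind

namespace StepFunction

/-- Both squares expand into double sums whose terms agree pairwise: two increments have covariance
equal to the length of the overlap of their intervals. No disjointness of the intervals is needed.
-/
lemma integral_sq_integral (hZ : IsPreBrownianReal Z μ) (φ : StepFunction) :
    ∫ ω, φ.integral Z ω ^ 2 ∂μ = ∫ u, φ.toFun u ^ 2 := by
  have hm : ∀ i, MemLp (fun ω => Z (φ.right i) ω - Z (φ.left i) ω) 2 μ := fun i =>
    ((hZ.isGaussianProcess.hasGaussianLaw_eval _).memLp_two).sub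
    (hZ.isGaussianProcess.hasGaussianLaw_eval _).memLp_two
  have hI : ∀ i : Fin φ.n, MemLp ((Set.Ioc (φ.left i : ℝ) (φ.right i : ℝ)).indicator
      (fun _ => φ.coef i)) 2 volume := fun i =>
    memLp_indicator_const _ measurableSet_Ioc _ (Or.inr (by simp))
  simp only [integral, toFun, sq, Finset.sum_mul_sum]
  rw [integral_finsetSum, integral_finsetSum]
  · refine Finset.sum_congr rfl fun i _ => ?_
    rw [integral_finsetSum, integral_finsetSum]
    · refine Finset.sum_congr rfl fun j _ => ?_
      have h1 : ∀ ω, φ.coef i * (Z (φ.right i) ω - Z (φ.left i) ω) *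
          (φ.coef j * (Z (φ.right j) ω - Z (φ.left j) ω)) = (φ.coef i * φ.coef j) *
          ((Z (φ.right i) ω - Z (φ.left i) ω) * (Z (φ.right j) ω - Z (φ.left j) ω)) :=
        fun ω => by ring
      simp_rw [h1, ← Set.inter_indicator_mul]
      rw [integral_const_mul, integral_increment_mul_increment hZ (φ.left_le_right i)
        (φ.left_le_right j), integral_indicator (measurableSet_Ioc.inter measurableSet_Ioc)]
      simp [mul_comm]
    · exact fun j _ => (hI i).integrable_mul (hI j)
    · exact fun j _ => ((hm i).const_mul _).integrable_mul ((hm j).const_mul _)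
  · exact fun i _ => integrable_finsetSum _ fun j _ => (hI i).integrable_mul (hI j)
  · exact fun i _ => integrable_finsetSum _ fun j _ =>
      ((hm i).const_mul _).integrable_mul ((hm j).const_mul _)

end StepFunction

lemma eLpNorm_two_eq_ofReal_sqrt {α : Type*} {m : MeasurableSpace α} {ν : Measure α} {f : α → ℝ}
    (hf : MemLp f 2 ν) : eLpNorm f 2 ν = ENNReal.ofReal √(∫ x, f x ^ 2 ∂ν) := by
  rw [hf.eLpNorm_eq_integral_rpow_norm (by simp) (by simp), Real.sqrt_eq_rpow]
  simp

/-- The Itô isometry for step functions. -/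
lemma StepFunction.eLpNorm_integral (hZ : IsPreBrownianReal Z μ) (φ : StepFunction) :
    eLpNorm (φ.integral Z) 2 μ = eLpNorm φ.toFun 2 volume := by
  rw [eLpNorm_two_eq_ofReal_sqrt (φ.memLp_integral hZ), eLpNorm_two_eq_ofReal_sqrt
    (φ.memLp_toFun 2), integral_sq_integral hZ]

lemma StepFunction.eLpNorm_integral_sub (hZ : IsPreBrownianReal Z μ) (φ ψ : StepFunction) :
    eLpNorm (fun ω => φ.integral Z ω - ψ.integral Z ω) 2 μ
      = eLpNorm (fun u => φ.toFun u - ψ.toFun u) 2 volume := by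
  have h := (φ.add ψ.neg).eLpNorm_integral hZ
  have h1 : (φ.add ψ.neg).integral Z = fun ω => φ.integral Z ω - ψ.integral Z ω := by
    ext ω; rw [integral_add, integral_neg, sub_eq_add_neg]
  have h2 : (φ.add ψ.neg).toFun = fun ω => φ.toFun ω - ψ.toFun ω := by
    ext ω; rw [toFun_add, toFun_neg, sub_eq_add_neg]
  rwa [h1, h2] at h

lemma eLpNorm_two_le_add {α : Type*} {m : MeasurableSpace α} {ν : Measure α}
    {f g h : α → ℝ} (hg : AEStronglyMeasurable g ν) (hh : AEStronglyMeasurable h ν)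
    (hf : ∀ x, f x = g x + h x) : eLpNorm f 2 ν ≤ eLpNorm g 2 ν + eLpNorm h 2 ν := by
  obtain rfl : f = g + h := funext hf
  exact eLpNorm_add_le hg hh (by norm_num)

lemma eLpNorm_sub_le_eLpNorm_sub_add {α : Type*} {m : MeasurableSpace α} {ν : Measure α}
    {f g h : α → ℝ} (hf : AEStronglyMeasurable f ν) (hg : AEStronglyMeasurable g ν)
    (hh : AEStronglyMeasurable h ν) :
    eLpNorm (fun x => f x - h x) 2 ν
      ≤ eLpNorm (fun x => f x - g x) 2 ν + eLpNorm (fun x => g x - h x) 2 ν :=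
  eLpNorm_two_le_add (hf.sub hg) (hg.sub hh) fun x => by simp

/-! ### Uniqueness and additivity of the Wiener integral -/

namespace IsWienerIntegral

variable {f : ℝ → ℝ} {a b c : ℝ≥0} {I J : Ω → ℝ}

/-- The Wiener integral is unique up to almost sure equality. -/
lemma ae_eq (hZ : IsPreBrownianReal Z μ)
    (hf : AEStronglyMeasurable ((Set.Ioc (a : ℝ) b).indicator f) volume)
    (hI : IsWienerIntegral μ Z f a b I) (hJ : IsWienerIntegral μ Z f a b J) : I =ᵐ[μ] J := by
  obtain ⟨hIm, φ, hφ, hφI⟩ := hI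
  obtain ⟨hJm, ψ, hψ, hψJ⟩ := hJ
  -- Triangle inequality along `I`, `∫ φ n dZ`, `∫ ψ n dZ`, `J`; the isometry turns the middle
  -- distance into one between step functions, both close to `f`.
  have hle : ∀ n, eLpNorm (fun ω => I ω - J ω) 2 μ ≤
      eLpNorm (fun ω => I ω - (φ n).integral Z ω) 2 μ +
      ((eLpNorm (fun u => (Set.Ioc (a : ℝ) b).indicator f u - (φ n).toFun u) 2 volume
        + eLpNorm (fun u => (Set.Ioc (a : ℝ) b).indicator f u - (ψ n).toFun u) 2 volume)
      + eLpNorm (fun ω => J ω - (ψ n).integral Z ω) 2 μ) := by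
    intro n
    have hφm := ((φ n).memLp_integral hZ).aestronglyMeasurable
    have hψm := ((ψ n).memLp_integral hZ).aestronglyMeasurable
    refine (eLpNorm_sub_le_eLpNorm_sub_add hIm.1 hφm hJm.1).trans ?_
    gcongr
    refine (eLpNorm_sub_le_eLpNorm_sub_add hφm hψm hJm.1).trans ?_
    rw [StepFunction.eLpNorm_integral_sub hZ]
    gcongr
    · refine (eLpNorm_sub_le_eLpNorm_sub_add ((φ n).memLp_toFun 2).1 hf
        ((ψ n).memLp_toFun 2).1).trans ?_
      rw [← eLpNorm_neg]
      simp [Pi.neg_def]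
    · rw [← eLpNorm_neg]
      simp [Pi.neg_def]
  have h0 : eLpNorm (fun ω => I ω - J ω) 2 μ = 0 := by
    exact le_antisymm (ge_of_tendsto' (by simpa using hφI.add ((hφ.add hψ).add hψJ)) hle) zero_le
  replace h0 := (eLpNorm_eq_zero_iff (hIm.1.sub hJm.1) (by simp)).1 h0
  filter_upwards [h0] with ω hω
  simpa [sub_eq_zero] using hω

/-- The Wiener integral is additive in the interval of integration. -/
lemma add_adjacent (hZ : IsPreBrownianReal Z μ) (hab : a ≤ b) (hbc : b ≤ c)
    (hf : AEStronglyMeasurable ((Set.Ioc (a : ℝ) b).indicator f) volume)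
    (hf' : AEStronglyMeasurable ((Set.Ioc (b : ℝ) c).indicator f) volume)
    (hI : IsWienerIntegral μ Z f a b I) (hJ : IsWienerIntegral μ Z f b c J) :
    IsWienerIntegral μ Z f a c (fun ω => I ω + J ω) := by
  obtain ⟨hIm, φ, hφ, hφI⟩ := hI
  obtain ⟨hJm, ψ, hψ, hψJ⟩ := hJ
  refine ⟨hIm.add hJm, fun n => (φ n).add (ψ n), ?_, ?_⟩
  · refine tendsto_of_tendsto_of_tendsto_of_le_of_le tendsto_const_nhds
      (by simpa using hφ.add hψ) (fun n => zero_le) fun n => ?_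
    refine eLpNorm_two_le_add (hf.sub ((φ n).memLp_toFun 2).1)
      (hf'.sub ((ψ n).memLp_toFun 2).1) fun u => ?_
    have h1 : (a : ℝ) ≤ b := by exact_mod_cast hab
    have h2 : (b : ℝ) ≤ c := by exact_mod_cast hbc
    simp only [StepFunction.toFun_add]
    rw [← Set.Ioc_union_Ioc_eq_Ioc h1 h2, Set.indicator_union_of_disjoint
      (Set.Ioc_disjoint_Ioc_of_le le_rfl)]
    ring
  · refine tendsto_of_tendsto_of_tendsto_of_le_of_le tendsto_const_nhds
      (by simpa using hφI.add hψJ) (fun n => zero_le) fun n => ?_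
    refine eLpNorm_two_le_add (hIm.1.sub ((φ n).memLp_integral hZ).1)
      (hJm.1.sub ((ψ n).memLp_integral hZ).1) fun u => ?_
    simp only [StepFunction.integral_add]
    ring

end IsWienerIntegral

/-! ### Approximation by step functions of partitions -/

namespace StepFunction

/-- The step function taking the value `c k` on `(p k, p (k + 1)]`, for `k < n`. -/
def ofPartition (p : ℕ → ℝ≥0) (hp : Monotone p) (c : ℕ → ℝ) (n : ℕ) : StepFunction where
  n := n
  coef i := c i
  left i := p i
  right i := p (i + 1)
  left_le_right i := hp (Nat.le_succ i)

variable {p : ℕ → ℝ≥0} {hp : Monotone p} {c : ℕ → ℝ} {n : ℕ}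

lemma integral_ofPartition (Z : ℝ≥0 → Ω → ℝ) (ω : Ω) :
    (ofPartition p hp c n).integral Z ω
      = ∑ k ∈ Finset.range n, c k * (Z (p (k + 1)) ω - Z (p k) ω) :=
  (Finset.sum_range fun k => c k * (Z (p (k + 1)) ω - Z (p k) ω)).symm

lemma toFun_ofPartition (u : ℝ) :
    (ofPartition p hp c n).toFun u
      = ∑ k ∈ Finset.range n, (Set.Ioc (p k : ℝ) (p (k + 1))).indicator (fun _ => c k) u :=
  (Finset.sum_range fun k => (Set.Ioc (p k : ℝ) (p (k + 1))).indicator (fun _ => c k) u).symm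

lemma measurable_integral_ofPartition (hZ : ∀ t, Measurable[F t] (Z t)) :
    Measurable[F (p n)] ((ofPartition p hp c n).integral Z) := by
  have h : (ofPartition p hp c n).integral Z
      = fun ω => ∑ k ∈ Finset.range n, c k * (Z (p (k + 1)) ω - Z (p k) ω) :=
    funext (integral_ofPartition Z)
  rw [h]
  refine Finset.measurable_fun_sum _ fun k hk => Measurable.const_mul (Measurable.sub ?_ ?_) _
  · exact (hZ _).mono (F.mono (hp (Finset.mem_range.1 hk))) le_rfl
  · exact (hZ _).mono (F.mono (hp (Finset.mem_range.1 hk).le)) le_rfl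

/-- The cells are disjoint, so at each point at most one of them contributes to the error. -/
lemma abs_indicator_sub_toFun_ofPartition_le {g : ℝ → ℝ} {δ : ℝ}
    (h : ∀ k < n, ∀ u ∈ Set.Ioc (p k : ℝ) (p (k + 1)), |g u - c k| ≤ δ) (u : ℝ) :
    |(Set.Ioc (p 0 : ℝ) (p n)).indicator g u - (ofPartition p hp c n).toFun u|
      ≤ (Set.Ioc (p 0 : ℝ) (p n)).indicator (fun _ => δ) u := by
  rw [toFun_ofPartition]
  induction n with
  | zero => simp
  | succ n ih =>
    have ih := ih fun k hk => h k (hk.trans n.lt_succ_self)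
    have hn := h n n.lt_succ_self u
    have h0 : (p 0 : ℝ) ≤ p n := by exact_mod_cast hp n.zero_le
    have h1 : (p n : ℝ) ≤ p (n + 1) := by exact_mod_cast hp n.le_succ
    rw [Finset.sum_range_succ, ← Set.Ioc_union_Ioc_eq_Ioc h0 h1,
      Set.indicator_union_of_disjoint (Set.Ioc_disjoint_Ioc_of_le le_rfl),
      Set.indicator_union_of_disjoint (Set.Ioc_disjoint_Ioc_of_le le_rfl)]
    by_cases hu : u ∈ Set.Ioc (p n : ℝ) (p (n + 1))
    · simp only [Set.indicator_of_mem hu]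
      have := hn hu
      rw [abs_le] at *
      constructor <;> linarith [ih.1, ih.2]
    · simpa only [Set.indicator_of_notMem hu, add_zero] using ih

end StepFunction

open StepFunction in
/-- Square integrable functions on `(a, b]` are approximated in `L²` by step functions of
partitions of `(a, b]`. -/
lemma exists_ofPartition_eLpNorm_le {f : ℝ → ℝ} {a b : ℝ≥0} (hab : a ≤ b)
    (hf : MemLp ((Set.Ioc (a : ℝ) b).indicator f) 2 volume) {ε : ℝ} (hε : 0 < ε) :
    ∃ (p : ℕ → ℝ≥0) (hp : Monotone p) (c : ℕ → ℝ) (n : ℕ), p 0 = a ∧ p n = b ∧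
      eLpNorm (fun u => (Set.Ioc (a : ℝ) b).indicator f u - (ofPartition p hp c n).toFun u) 2
        volume ≤ ENNReal.ofReal ε := by
  have hab' : (a : ℝ) ≤ b := by exact_mod_cast hab
  obtain ⟨g, hgs, hg, hgc, hgm⟩ := hf.exists_hasCompactSupport_eLpNorm_sub_le (by simp)
    (ε := ENNReal.ofReal (ε / 2)) (by simpa using hε)
  have hgu : UniformContinuous g := hgs.uniformContinuous_of_continuous hgc
  -- Chosen so that `δ * √(b - a) ≤ ε / 2`; the `+ 1` keeps the denominator positive when `a = b`.
  set δ : ℝ := ε / 2 / (√(b - a) + 1) with hδ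
  have hs : 0 < √((b : ℝ) - a) + 1 := by positivity
  have hδ0 : 0 < δ := by positivity
  obtain ⟨η, hη, hgη⟩ := Metric.uniformContinuous_iff.1 hgu δ hδ0
  obtain ⟨n, hn⟩ := exists_nat_gt (((b : ℝ) - a) / η)
  have hn0 : (0 : ℝ) < n := lt_of_le_of_lt (div_nonneg (by linarith) hη.le) hn
  have hnn : (n : ℝ≥0) ≠ 0 := by
    have : n ≠ 0 := by rintro rfl; simp at hn0
    exact_mod_cast this
  let p : ℕ → ℝ≥0 := fun k => a + k * ((b - a) / n)
  have hp : Monotone p := fun i j hij => by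
    have : (i : ℝ≥0) ≤ j := by exact_mod_cast hij
    simp only [p]
    gcongr
  have hp0 : p 0 = a := by simp [p]
  have hpn : p n = b := by
    simp only [p]
    rw [mul_div_cancel₀ _ hnn, add_tsub_cancel_of_le hab]
  have hstep : ∀ k, (p (k + 1) : ℝ) - p k < η := fun k => by
    simp only [p, NNReal.coe_add, NNReal.coe_mul, NNReal.coe_div, NNReal.coe_sub hab]
    push_cast
    rw [div_lt_iff₀ hη] at hn
    have : ((b : ℝ) - a) / n < η := by rw [div_lt_iff₀ hn0]; linarith
    linarith
  refine ⟨p, hp, fun k => g (p k), n, hp0, hpn, ?_⟩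
  have hb := abs_indicator_sub_toFun_ofPartition_le (hp := hp) (n := n) (c := fun k => g (p k))
    (g := g) (δ := δ) fun k hk u hu => by
      rw [← Real.dist_eq]
      refine (hgη ?_).le
      rw [Real.dist_eq, abs_of_pos (by linarith [hu.1])]
      linarith [hu.2, hstep k]
  rw [hp0, hpn] at hb
  -- The continuous approximant `g` may live outside `(a, b]`; truncating to the interval does not
  -- increase the error.
  have h1 : eLpNorm ((Set.Ioc (a : ℝ) b).indicator ((Set.Ioc (a : ℝ) b).indicator f - g)) 2 volume
      ≤ ENNReal.ofReal (ε / 2) := (eLpNorm_indicator_le _).trans hg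
  have h2 : eLpNorm (fun u => (Set.Ioc (a : ℝ) b).indicator g u
      - (ofPartition p hp (fun k => g (p k)) n).toFun u) 2 volume ≤ ENNReal.ofReal (ε / 2) := by
    refine (eLpNorm_mono_real hb).trans ?_
    rw [eLpNorm_indicator_const measurableSet_Ioc (by simp) (by simp), Real.volume_Ioc,
      Real.enorm_eq_ofReal hδ0.le, ENNReal.ofReal_rpow_of_nonneg (by linarith) (by simp),
      ← ENNReal.ofReal_mul hδ0.le]
    refine ENNReal.ofReal_le_ofReal ?_
    rw [ENNReal.toReal_ofNat, ← Real.sqrt_eq_rpow, hδ, div_mul_eq_mul_div, div_le_iff₀ hs]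
    nlinarith
  have hmeas : AEStronglyMeasurable ((Set.Ioc (a : ℝ) b).indicator g) volume :=
    hgc.aestronglyMeasurable.indicator measurableSet_Ioc
  refine (eLpNorm_two_le_add ((hf.1.sub hgc.aestronglyMeasurable).indicator measurableSet_Ioc)
    (hmeas.sub ((ofPartition p hp (fun k => g (p k)) n).memLp_toFun 2).1) fun u => ?_).trans
    ((add_le_add h1 h2).trans ?_)
  · by_cases hu : u ∈ Set.Ioc (a : ℝ) b <;> simp [hu]
  · rw [← ENNReal.ofReal_add (by positivity) (by positivity), add_halves]

/-! ### Conditional characteristic functions and independence -/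

lemma indepFun_increment (hZ : IsFilteredBrownian Z F μ) {s t : ℝ≥0} (hst : s ≤ t)
    {Y : Ω → ℂ} (hY : Measurable[F s] Y) {h : ℝ → ℂ} (hh : Measurable h) :
    IndepFun Y (fun ω => h (Z t ω - Z s ω)) μ := by
  rw [IndepFun_iff_Indep]
  refine indep_of_indep_of_le_left (indep_of_indep_of_le_right (hZ.indep s t hst).symm ?_)
    hY.comap_le
  exact (hh.comp (comap_measurable _)).comap_le

lemma integral_cexp_increment (hZ : IsPreBrownianReal Z μ) {s t : ℝ≥0} (hst : s ≤ t) (x : ℝ) :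
    ∫ ω, Complex.exp (x * (Z t ω - Z s ω : ℝ) * Complex.I) ∂μ
      = Complex.exp (-(x ^ 2 * ((t : ℝ) - s) / 2 : ℝ)) := by
  have hl := hZ.hasLaw_sub t s
  have h := charFun_gaussianReal (μ := 0) (v := nndist t.1 s.1) x
  rw [← hl.map_eq, charFun_apply_real, integral_map hl.aemeasurable (by fun_prop)] at h
  simp only [Pi.sub_apply] at h
  rw [h]
  congr 1
  have : ((nndist t.1 s.1 : ℝ≥0) : ℝ) = t - s := by
    rw [coe_nndist, Real.dist_eq]
    exact abs_of_nonneg (sub_nonneg.2 (by exact_mod_cast hst))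
  rw [this]
  push_cast
  ring

/-- The characteristic function of the elementary integral of a step function, conditionally on
the information available at the left end point. -/
lemma setIntegral_cexp_ofPartition [IsProbabilityMeasure μ] (hZ : IsFilteredBrownian Z F μ)
    {p : ℕ → ℝ≥0} {hp : Monotone p} {c : ℕ → ℝ} (n : ℕ) {A : Set Ω}
    (hA : MeasurableSet[F (p 0)] A) (x : ℝ) :
    ∫ ω in A, Complex.exp (x * ((StepFunction.ofPartition p hp c n).integral Z ω) * Complex.I) ∂μ
      = μ.real A * Complex.exp
        (-(x ^ 2 / 2 * ∑ k ∈ Finset.range n, c k ^ 2 * ((p (k + 1) : ℝ) - p k) : ℝ)) := by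
  induction n with
  | zero => simp [StepFunction.integral_ofPartition]
  | succ n ih =>
    have hAm : MeasurableSet A := F.le _ _ hA
    rw [← integral_indicator hAm] at ih ⊢
    set X : Ω → ℂ := A.indicator fun ω =>
      Complex.exp (x * ((StepFunction.ofPartition p hp c n).integral Z ω) * Complex.I) with hX
    have hXm : Measurable[F (p n)] X := by
      refine Measurable.indicator ?_ (F.mono (hp n.zero_le) _ hA)
      have h0 := StepFunction.measurable_integral_ofPartition (p := p) (hp := hp) (c := c) (n := n)
        hZ.adapted
      have h1 : Measurable fun y : ℝ => Complex.exp (x * y * Complex.I) := by fun_prop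
      exact h1.comp h0
    -- The indicator of `A` is absorbed into the past factor `X`, which is then independent of the
    -- next increment.
    have hfac : (A.indicator fun ω => Complex.exp
        (x * ((StepFunction.ofPartition p hp c (n + 1)).integral Z ω) * Complex.I))
        = fun ω => X ω * Complex.exp
          ((x * c n : ℝ) * (Z (p (n + 1)) ω - Z (p n) ω : ℝ) * Complex.I) := by
      ext ω
      by_cases hω : ω ∈ A
      · simp only [hX, Set.indicator_of_mem hω, ← Complex.exp_add]
        congr 1
        simp only [StepFunction.integral_ofPartition, Finset.sum_range_succ]
        push_cast
        ring
      · simp [hX, hω]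
    rw [hfac, IndepFun.integral_fun_mul_eq_mul_integral (indepFun_increment hZ (hp n.le_succ) hXm
      (h := fun y => Complex.exp ((x * c n : ℝ) * y * Complex.I)) (by fun_prop)), ih,
      integral_cexp_increment hZ.isBrownian.toIsPreBrownianReal (hp n.le_succ), mul_assoc,
      ← Complex.exp_add, Finset.sum_range_succ]
    · congr 2
      push_cast
      ring
    · exact (hXm.mono (F.le _) le_rfl).aestronglyMeasurable
    · have h1 : Measurable fun y : ℝ => Complex.exp ((x * c n : ℝ) * y * Complex.I) := by fun_prop
      have hz : ∀ t, Measurable (Z t) := fun t => (hZ.adapted t).mono (F.le _) le_rfl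
      exact (h1.comp ((hz _).sub (hz _))).aestronglyMeasurable

/-- A random variable whose characteristic function, restricted to every event of `m`, is that
of a centred Gaussian law has this law. -/
lemma map_eq_gaussianReal_of_setIntegral_cexp [IsProbabilityMeasure μ] {W : Ω → ℝ}
    (hW : Measurable W) {v : ℝ≥0}
    (h : ∀ x : ℝ, ∫ ω, Complex.exp (x * W ω * Complex.I) ∂μ
      = Complex.exp (-(x ^ 2 / 2 * v : ℝ))) : μ.map W = gaussianReal 0 v := by
  have : IsProbabilityMeasure (μ.map W) := Measure.isProbabilityMeasure_map hW.aemeasurable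
  refine Measure.ext_of_charFun (funext fun x => ?_)
  rw [charFun_gaussianReal, charFun_apply_real, integral_map hW.aemeasurable (by fun_prop), h]
  congr 1
  push_cast
  ring

/-- If the characteristic function of `W` on every event of `m` factorizes, then `W` is
independent of `m`. -/
lemma indep_of_setIntegral_cexp {Ω : Type*} {m mΩ : MeasurableSpace Ω} {μ : Measure Ω}
    [IsProbabilityMeasure μ] {W : Ω → ℝ} (hW : Measurable W) (hm : m ≤ mΩ)
    (h : ∀ A, MeasurableSet[m] A → ∀ x : ℝ, ∫ ω in A, Complex.exp (x * W ω * Complex.I) ∂μ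
      = μ.real A * ∫ ω, Complex.exp (x * W ω * Complex.I) ∂μ) :
    Indep (MeasurableSpace.comap W inferInstance) m μ := by
  rw [Indep_iff]
  rintro _ A ⟨B, hB, rfl⟩ hA
  have hAm := hm _ hA
  -- Both sides are finite measures on the line, so equality of characteristic functions suffices.
  have key : (μ.restrict A).map W = (μ A) • μ.map W := by
    have : IsFiniteMeasure ((μ A) • μ.map W) := by
      refine ⟨?_⟩
      rw [Measure.smul_apply, smul_eq_mul]
      exact ENNReal.mul_lt_top (measure_lt_top _ _) (measure_lt_top _ _)
    refine Measure.ext_of_charFun (funext fun x => ?_)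
    rw [charFun_apply_real, charFun_apply_real, integral_smul_measure,
      integral_map hW.aemeasurable (by fun_prop), integral_map hW.aemeasurable (by fun_prop),
      h A hA]
    simp [Measure.real]
  have := congrArg (fun ν => ν B) key
  simp only [Measure.map_apply hW hB, Measure.smul_apply, smul_eq_mul,
    Measure.restrict_apply (hW hB)] at this
  rw [this, mul_comm]

/-- Both sides are the variance of the same elementary integral: the left one is read off its
Gaussian law, the right one comes from the isometry. -/
lemma StepFunction.sum_eq_integral_toFun_sq [IsProbabilityMeasure μ]
    (hZ : IsFilteredBrownian Z F μ) {p : ℕ → ℝ≥0} {hp : Monotone p} {c : ℕ → ℝ} {n : ℕ} :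
    ∑ k ∈ Finset.range n, c k ^ 2 * ((p (k + 1) : ℝ) - p k)
      = ∫ u, (StepFunction.ofPartition p hp c n).toFun u ^ 2 := by
  have hv : 0 ≤ ∑ k ∈ Finset.range n, c k ^ 2 * ((p (k + 1) : ℝ) - p k) :=
    Finset.sum_nonneg fun k _ => mul_nonneg (sq_nonneg _)
      (sub_nonneg.2 (by exact_mod_cast hp k.le_succ))
  have hm : Measurable ((StepFunction.ofPartition p hp c n).integral Z) :=
    (measurable_integral_ofPartition hZ.adapted).mono (F.le _) le_rfl
  have hl := map_eq_gaussianReal_of_setIntegral_cexp (μ := μ) hm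
    (v := (∑ k ∈ Finset.range n, c k ^ 2 * ((p (k + 1) : ℝ) - p k)).toNNReal) fun x => by
      rw [Real.coe_toNNReal _ hv]
      simpa using setIntegral_cexp_ofPartition hZ (hp := hp) (c := c) n MeasurableSet.univ x
  have h0 : ∫ ω, (StepFunction.ofPartition p hp c n).integral Z ω ∂μ = 0 := by
    rw [← integral_map (φ := (StepFunction.ofPartition p hp c n).integral Z) (f := fun y => y)
      hm.aemeasurable (by fun_prop), hl, integral_id_gaussianReal]
  have hvar := variance_of_integral_eq_zero hm.aemeasurable h0
  rw [integral_sq_integral hZ.isBrownian.toIsPreBrownianReal] at hvar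
  rw [← hvar, ← variance_id_map hm.aemeasurable, hl, variance_id_gaussianReal,
    Real.coe_toNNReal _ hv]

/-! ### Existence, law and independence of the Wiener integral -/

lemma eLpNorm_sub_tendsto_iff {α : Type*} {m : MeasurableSpace α} {ν : Measure α}
    {f : ℕ → α → ℝ} {g : α → ℝ} (hf : ∀ n, MemLp (f n) 2 ν) (hg : MemLp g 2 ν) :
    Tendsto (fun n => (hf n).toLp (f n)) atTop (𝓝 (hg.toLp g)) ↔
      Tendsto (fun n => eLpNorm (fun x => g x - f n x) 2 ν) atTop (𝓝 0) := by
  rw [Lp.tendsto_Lp_iff_tendsto_eLpNorm'']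
  refine tendsto_congr fun n => ?_
  exact eLpNorm_sub_comm _ _ _ _

/-- The Wiener integral of a square integrable function over `(a, b]` exists; it is a centred
Gaussian variable, measurable at time `b` and independent of the past of time `a`. -/
theorem exists_isWienerIntegral [IsProbabilityMeasure μ] (hZ : IsFilteredBrownian Z F μ)
    {f : ℝ → ℝ} {a b : ℝ≥0} (hab : a ≤ b)
    (hf : MemLp ((Set.Ioc (a : ℝ) b).indicator f) 2 volume) :
    ∃ W : Ω → ℝ, IsWienerIntegral μ Z f a b W ∧ Measurable[F b] W ∧
      μ.map W = gaussianReal 0 (∫ u in Set.Ioc (a : ℝ) b, f u ^ 2).toNNReal ∧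
      Indep (MeasurableSpace.comap W inferInstance) (F a) μ := by
  have hB := hZ.isBrownian.toIsPreBrownianReal
  choose p hp c n hpa hpb hle using fun k : ℕ =>
    exists_ofPartition_eLpNorm_le hab hf (ε := 1 / ((k : ℝ) + 1)) (by positivity)
  set φ : ℕ → StepFunction := fun k => StepFunction.ofPartition (p k) (hp k) (c k) (n k) with hφdef
  have hφm : ∀ k, MemLp (φ k).toFun 2 volume := fun k => (φ k).memLp_toFun 2
  have hXm : ∀ k, MemLp ((φ k).integral Z) 2 μ := fun k => (φ k).memLp_integral hB
  have hφ : Tendsto (fun k => eLpNorm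
      (fun u => (Set.Ioc (a : ℝ) b).indicator f u - (φ k).toFun u) 2 volume) atTop (𝓝 0) := by
    refine tendsto_of_tendsto_of_tendsto_of_le_of_le tendsto_const_nhds ?_
      (fun _ => zero_le) hle
    simpa using ENNReal.tendsto_ofReal tendsto_one_div_add_atTop_nhds_zero_nat
  have hφL := (eLpNorm_sub_tendsto_iff hφm hf).2 hφ
  -- By the isometry, the integrals are at the same mutual distances as the convergent step
  -- functions.
  have hcauchy : CauchySeq fun k => (hXm k).toLp ((φ k).integral Z) := by
    have h1 := hφL.cauchySeq
    rw [Metric.cauchySeq_iff] at h1 ⊢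
    have hdist : ∀ i j, dist ((hXm i).toLp ((φ i).integral Z)) ((hXm j).toLp ((φ j).integral Z))
        = dist ((hφm i).toLp (φ i).toFun) ((hφm j).toLp (φ j).toFun) := fun i j => by
      rw [dist_edist, dist_edist, Lp.edist_toLp_toLp, Lp.edist_toLp_toLp]
      exact congrArg _ ((φ i).eLpNorm_integral_sub hB (φ j))
    simpa only [hdist] using h1
  obtain ⟨L, hL⟩ := cauchySeq_tendsto_of_complete hcauchy
  have hXmeas : ∀ k, Measurable[F b] ((φ k).integral Z) := fun k => by
    have := StepFunction.measurable_integral_ofPartition (p := p k) (hp := hp k) (c := c k)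
      (n := n k) hZ.adapted
    rwa [hpb] at this
  -- Measurability at time `b` is a closed condition in `L²`; it provides the representative `W`
  -- that is genuinely `F b`-measurable.
  have hLm : AEStronglyMeasurable[F b] L μ := by
    refine (isClosed_aestronglyMeasurable (F := ℝ) (p := 2) (μ := μ) (F.le b)).mem_of_tendsto hL
      (Eventually.of_forall fun k => ?_)
    exact (hXmeas k).stronglyMeasurable.aestronglyMeasurable.congr (hXm k).coeFn_toLp.symm
  obtain ⟨W, hWs, hLW⟩ := hLm
  have hWL : MemLp W 2 μ := (Lp.memLp L).ae_eq hLW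
  have hWm : Measurable W := hWs.measurable.mono (F.le b) le_rfl
  have hX : Tendsto (fun k => eLpNorm (fun ω => W ω - (φ k).integral Z ω) 2 μ) atTop (𝓝 0) := by
    rw [← eLpNorm_sub_tendsto_iff hXm hWL]
    convert hL using 2
    rw [← Lp.toLp_coeFn L (Lp.memLp L)]
    exact MemLp.toLp_congr _ _ hLW.symm
  have hint : ∀ g : ℝ → ℝ, ∫ u, (Set.Ioc (a : ℝ) b).indicator g u ^ 2
      = ∫ u in Set.Ioc (a : ℝ) b, g u ^ 2 := fun g => by
    rw [← integral_indicator measurableSet_Ioc]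
    congr 1; ext u
    by_cases hu : u ∈ Set.Ioc (a : ℝ) b <;> simp [hu]
  have hvar : Tendsto (fun k => ∫ u, (φ k).toFun u ^ 2) atTop
      (𝓝 (∫ u in Set.Ioc (a : ℝ) b, f u ^ 2)) := by
    have h1 := (hφL.norm).pow 2
    have h2 : ∀ {g : ℝ → ℝ} (hg : MemLp g 2 volume), ‖hg.toLp g‖ ^ 2 = ∫ u, g u ^ 2 := by
      intro g hg
      rw [Lp.norm_toLp, eLpNorm_two_eq_ofReal_sqrt hg, ENNReal.toReal_ofReal (Real.sqrt_nonneg _),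
        Real.sq_sqrt (integral_nonneg fun _ => sq_nonneg _)]
    simpa only [h2, hint] using h1
  have hv0 : 0 ≤ ∫ u in Set.Ioc (a : ℝ) b, f u ^ 2 := integral_nonneg fun _ => sq_nonneg _
  -- Along an almost surely convergent subsequence, dominated convergence (the integrands have
  -- modulus one) passes to the limit in the formula for partitions.
  have hcexp : ∀ A, MeasurableSet[F a] A → ∀ x : ℝ,
      ∫ ω in A, Complex.exp (x * W ω * Complex.I) ∂μ
      = μ.real A * Complex.exp (-(x ^ 2 / 2 * ∫ u in Set.Ioc (a : ℝ) b, f u ^ 2 : ℝ)) := by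
    intro A hA x
    have hmeas : TendstoInMeasure μ (fun k => (φ k).integral Z) atTop W := by
      refine tendstoInMeasure_of_tendsto_eLpNorm (p := 2) (by simp) (fun k => (hXm k).1) hWL.1 ?_
      refine hX.congr fun k => eLpNorm_sub_comm _ _ _ _
    obtain ⟨ns, hns, hae⟩ := hmeas.exists_seq_tendsto_ae
    refine tendsto_nhds_unique (f := fun i => ∫ ω in A,
      Complex.exp (x * ((φ (ns i)).integral Z ω) * Complex.I) ∂μ) (l := atTop) ?_ ?_
    · refine tendsto_integral_of_dominated_convergence (fun _ => 1) (fun i => ?_)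
        (integrable_const _) (fun i => ?_) ?_
      · have h1 : Measurable fun y : ℝ => Complex.exp (x * y * Complex.I) := by fun_prop
        exact (h1.comp ((hXmeas (ns i)).mono (F.le b) le_rfl)).aestronglyMeasurable
      · refine Eventually.of_forall fun ω => ?_
        rw [← Complex.ofReal_mul, Complex.norm_exp_ofReal_mul_I]
      · filter_upwards [ae_restrict_of_ae hae] with ω hω
        have h1 : Continuous fun y : ℝ => Complex.exp (x * y * Complex.I) := by fun_prop
        exact (h1.tendsto _).comp hω
    · have h1 : ∀ i, ∫ ω in A, Complex.exp (x * ((φ (ns i)).integral Z ω) * Complex.I) ∂μ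
          = μ.real A * Complex.exp (-(x ^ 2 / 2 * ∫ u, (φ (ns i)).toFun u ^ 2 : ℝ)) := fun i => by
        have h2 := setIntegral_cexp_ofPartition hZ (p := p (ns i)) (hp := hp (ns i))
          (c := c (ns i)) (n (ns i)) (A := A) (by rwa [hpa]) x
        rwa [StepFunction.sum_eq_integral_toFun_sq hZ (hp := hp (ns i))] at h2
      simp_rw [h1]
      have h3 : Continuous fun y : ℝ => (μ.real A : ℂ) * Complex.exp (-(x ^ 2 / 2 * y : ℝ)) := by
        fun_prop
      exact (h3.tendsto _).comp (hvar.comp hns.tendsto_atTop)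
  have huniv : ∀ x : ℝ, ∫ ω, Complex.exp (x * W ω * Complex.I) ∂μ
      = Complex.exp (-(x ^ 2 / 2 * ∫ u in Set.Ioc (a : ℝ) b, f u ^ 2 : ℝ)) := fun x => by
    simpa using hcexp Set.univ MeasurableSet.univ x
  refine ⟨W, ⟨hWL, φ, hφ, hX⟩, hWs.measurable, ?_, ?_⟩
  · refine map_eq_gaussianReal_of_setIntegral_cexp hWm fun x => ?_
    rw [Real.coe_toNNReal _ hv0, huniv]
  · refine indep_of_setIntegral_cexp hWm (F.le a) fun A hA x => ?_
    rw [hcexp A hA, huniv]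

/-! ### The fractional kernel and its bracket -/

lemma kernel_sq {H : ℝ} {t : ℝ≥0} {u : ℝ} (hu : u ≤ t) :
    kernel H t u ^ 2 = ((t : ℝ) - u) ^ (2 * H - 1) := by
  rw [kernel, ← Real.rpow_mul_natCast (sub_nonneg.2 hu)]
  congr 1
  push_cast
  ring

lemma memLp_kernel {H : ℝ} (hH : 0 < H) {s T t : ℝ≥0} (hT : T ≤ t) :
    MemLp ((Set.Ioc (s : ℝ) T).indicator (kernel H t)) 2 volume := by
  have hT' : (T : ℝ) ≤ t := by exact_mod_cast hT
  have hm : Measurable (kernel H t) := by unfold kernel; fun_prop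
  rw [memLp_indicator_iff_restrict measurableSet_Ioc,
    memLp_two_iff_integrable_sq hm.aestronglyMeasurable]
  change IntegrableOn _ _ _
  -- The singularity at `u = t` is integrable because `2 * H - 1 > -1`.
  have h1 : IntervalIntegrable (fun u : ℝ => ((t : ℝ) - u) ^ (2 * H - 1)) volume s T := by
    have h2 := (intervalIntegral.intervalIntegrable_rpow' (a := (t : ℝ) - s) (b := t - T)
      (r := 2 * H - 1) (by linarith)).comp_sub_left t
    rwa [sub_sub_cancel, sub_sub_cancel] at h2
  refine h1.1.congr_fun (fun u hu => ?_) measurableSet_Ioc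
  exact (kernel_sq (hu.2.trans hT')).symm

lemma setIntegral_kernel_sq {H : ℝ} (hH : 0 < H) {T t : ℝ≥0} (hT : T ≤ t) :
    ∫ u in Set.Ioc (T : ℝ) t, kernel H t u ^ 2 = ((t : ℝ) - T) ^ (2 * H) / (2 * H) := by
  have hT' : (T : ℝ) ≤ t := by exact_mod_cast hT
  rw [setIntegral_congr_fun measurableSet_Ioc fun u hu => kernel_sq hu.2,
    ← intervalIntegral.integral_of_le hT',
    intervalIntegral.integral_comp_sub_left (fun x : ℝ => x ^ (2 * H - 1)),
    integral_rpow (Or.inl (by linarith)), sub_self, sub_add_cancel,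
    Real.zero_rpow (by positivity), sub_zero]

lemma volterraBracket_eq {H : ℝ} (hH : 0 < H) (t : ℝ≥0) :
    volterraBracket H t = (t : ℝ) ^ (2 * H) / (2 * H) := by
  rw [volterraBracket, intervalIntegral.integral_of_le t.coe_nonneg]
  simpa using setIntegral_kernel_sq hH (zero_le (a := t))

/-! ### Chosen versions and exponentials of independent Gaussian variables -/

lemma IsWienerIntegral.wienerIntegral_ae_eq (hZ : IsPreBrownianReal Z μ) {f : ℝ → ℝ} {a b : ℝ≥0}
    {I : Ω → ℝ} (hf : AEStronglyMeasurable ((Set.Ioc (a : ℝ) b).indicator f) volume)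
    (hI : IsWienerIntegral μ Z f a b I) : wienerIntegral μ Z f a b =ᵐ[μ] I := by
  have h : ∃ I, IsWienerIntegral μ Z f a b I := ⟨I, hI⟩
  rw [wienerIntegral, dif_pos h]
  exact h.choose_spec.ae_eq hZ hf hI

/-- Integrability and mean of the product of a variable `G` known at time `s` and of the exponential
of a centred Gaussian variable independent of the past of time `s`. -/
lemma integrable_mul_exp_and_integral {m mΩ : MeasurableSpace Ω} {μ : Measure Ω}
    {G W : Ω → ℝ} {v : ℝ≥0} (hG : Measurable[m] G)
    (hGi : Integrable G μ) (hW : Measurable W) (hlaw : μ.map W = gaussianReal 0 v)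
    (hind : Indep (MeasurableSpace.comap W inferInstance) m μ) (c : ℝ) :
    Integrable (fun ω => Real.exp (c * W ω)) μ ∧
    ∫ ω, Real.exp (c * W ω) ∂μ = Real.exp (c ^ 2 / 2 * v) ∧
    Integrable (fun ω => G ω * Real.exp (c * W ω)) μ ∧
    ∫ ω, G ω * Real.exp (c * W ω) ∂μ = (∫ ω, G ω ∂μ) * Real.exp (c ^ 2 / 2 * v) := by
  have he : Integrable (fun ω => Real.exp (c * W ω)) μ := by
    have := integrable_exp_mul_gaussianReal (μ := 0) (v := v) c
    rw [← hlaw] at this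
    exact this.comp_measurable hW
  have hE : ∫ ω, Real.exp (c * W ω) ∂μ = Real.exp (c ^ 2 / 2 * v) := by
    have := mgf_gaussianReal hlaw c
    rw [mgf] at this
    rw [this]
    congr 1
    ring
  have hi : IndepFun G (fun ω => Real.exp (c * W ω)) μ := by
    rw [IndepFun_iff_Indep]
    refine indep_of_indep_of_le_left (indep_of_indep_of_le_right hind.symm ?_) hG.comap_le
    have h1 : Measurable fun y : ℝ => Real.exp (c * y) := by fun_prop
    exact (h1.comp (comap_measurable W)).comap_le
  refine ⟨he, hE, hi.integrable_mul hGi he, ?_⟩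
  rw [hi.integral_fun_mul_eq_mul_integral hGi.1 he.1, hE]

/-- The conditional expectation of such a product. -/
lemma condExp_mul_exp {m mΩ : MeasurableSpace Ω} {μ : Measure Ω} [IsProbabilityMeasure μ]
    (hm : m ≤ mΩ) {G W : Ω → ℝ} {v : ℝ≥0} (hG : Measurable[m] G)
    (hGi : Integrable G μ) (hW : Measurable W) (hlaw : μ.map W = gaussianReal 0 v)
    (hind : Indep (MeasurableSpace.comap W inferInstance) m μ) (c : ℝ) :
    μ[fun ω => G ω * Real.exp (c * W ω) | m]
      =ᵐ[μ] fun ω => G ω * Real.exp (c ^ 2 / 2 * v) := by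
  obtain ⟨he, hE, hGe, -⟩ := integrable_mul_exp_and_integral hG hGi hW hlaw hind c
  have h1 : μ[fun ω => Real.exp (c * W ω) | m] =ᵐ[μ] fun _ => Real.exp (c ^ 2 / 2 * v) := by
    rw [← hE]
    refine condExp_indep_eq hW.comap_le hm ?_ hind
    have h1 : Measurable fun y : ℝ => Real.exp (c * y) := by fun_prop
    exact (h1.comp (comap_measurable W)).stronglyMeasurable
  have h2 := condExp_mul_of_aestronglyMeasurable_left (m := m) (μ := μ)
    hG.stronglyMeasurable.aestronglyMeasurable (g := fun ω => Real.exp (c * W ω)) hGe he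
  refine h2.trans ?_
  filter_upwards [h1] with ω hω
  simp only [Pi.mul_apply, hω]

lemma exists_volterra_ae_eq [IsProbabilityMeasure μ] (hZ : IsFilteredBrownian Z F μ)
    {H : ℝ} (hH : 0 < H) (t : ℝ≥0) :
    ∃ W : Ω → ℝ, volterra μ Z H t =ᵐ[μ] W ∧ Measurable W ∧
      μ.map W = gaussianReal 0 (volterraBracket H t).toNNReal ∧
      Indep (MeasurableSpace.comap W inferInstance) (F 0) μ := by
  have hk := memLp_kernel hH (s := 0) (le_refl t)
  obtain ⟨W, hW, hWm, hlaw, hind⟩ := exists_isWienerIntegral hZ zero_le hk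
  refine ⟨W, hW.wienerIntegral_ae_eq hZ.isBrownian.toIsPreBrownianReal hk.1,
    hWm.mono (F.le t) le_rfl, ?_, hind⟩
  rw [hlaw, volterraBracket, intervalIntegral.integral_of_le t.coe_nonneg, NNReal.coe_zero]

lemma volterraBracket_nonneg (H : ℝ) (t : ℝ≥0) : 0 ≤ volterraBracket H t :=
  intervalIntegral.integral_nonneg t.2 fun _ _ => sq_nonneg _

/-! ### Forward variance and variance swaps -/

section Variance

variable [IsProbabilityMeasure μ] {H ν : ℝ} {ξ₀ V : ℝ≥0 → Ω → ℝ}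

/-- The instantaneous variance is integrable, with the mean of the initial forward variance. -/
lemma IsInstantaneousVariance.integrable_and_integral
    (hV : IsInstantaneousVariance μ Z H ν ξ₀ V) (hZ : IsFilteredBrownian Z F μ)
    (hH : 0 < H) (hξ_meas : ∀ t, Measurable[F 0] (ξ₀ t)) (hξ_int : ∀ t, Integrable (ξ₀ t) μ)
    (t : ℝ≥0) : Integrable (V t) μ ∧ ∫ ω, V t ω ∂μ = ∫ ω, ξ₀ t ω ∂μ := by
  obtain ⟨W, hW, hWm, hlaw, hind⟩ := exists_volterra_ae_eq hZ hH t
  set c := 2 * ν * cH H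
  obtain ⟨-, -, hi, hint⟩ := integrable_mul_exp_and_integral (hξ_meas t) (hξ_int t)
    hWm hlaw hind c
  have hVW : V t =ᵐ[μ] fun ω => ξ₀ t ω * Real.exp (c * W ω)
      * Real.exp (-(c ^ 2 / 2 * volterraBracket H t)) := by
    filter_upwards [hV t, hW] with ω h1 h2
    rw [h1, stochasticExp, h2, sub_eq_add_neg, Real.exp_add, mul_assoc (ξ₀ t ω)]
  refine ⟨(hi.mul_const _).congr hVW.symm, ?_⟩
  rw [integral_congr_ae hVW, integral_mul_const, hint,
    Real.coe_toNNReal _ (volterraBracket_nonneg H t), mul_assoc, ← Real.exp_add, add_neg_cancel,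
    Real.exp_zero, mul_one]

/-- The forward variance curve of the rough Bergomi model. -/
theorem IsInstantaneousVariance.forwardVariance_ae_eq
    (hV : IsInstantaneousVariance μ Z H ν ξ₀ V) (hZ : IsFilteredBrownian Z F μ)
    (hH : 0 < H) (hξ_meas : ∀ t, Measurable[F 0] (ξ₀ t)) (hξ_int : ∀ t, Integrable (ξ₀ t) μ)
    {T t : ℝ≥0} (hT : T ≤ t) :
    forwardVariance μ F V T t =ᵐ[μ] fun ω => ξ₀ t ω * eta μ Z H ν T t ω *
      Real.exp (ν ^ 2 * cH H ^ 2 / H * (((t : ℝ) - T) ^ (2 * H) - (t : ℝ) ^ (2 * H))) := by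
  have hB := hZ.isBrownian.toIsPreBrownianReal
  have hk1 := memLp_kernel hH (s := 0) hT
  have hk2 := memLp_kernel hH (s := T) (le_refl t)
  have hk := memLp_kernel hH (s := 0) (le_refl t)
  obtain ⟨X, hX, hXm, hXlaw, hXind⟩ := exists_isWienerIntegral hZ zero_le hk1
  obtain ⟨W, hW, hWm, hWlaw, hWind⟩ := exists_isWienerIntegral hZ hT hk2
  have hXe : truncatedVolterra μ Z H T t =ᵐ[μ] X := hX.wienerIntegral_ae_eq hB hk1.1
  have hVe : volterra μ Z H t =ᵐ[μ] fun ω => X ω + W ω :=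
    (hX.add_adjacent hB zero_le hT hk1.1 hk2.1 hW).wienerIntegral_ae_eq hB hk.1
  set c := 2 * ν * cH H with hc
  obtain ⟨-, -, hGi, -⟩ := integrable_mul_exp_and_integral (hξ_meas t) (hξ_int t)
    (hXm.mono (F.le T) le_rfl) hXlaw hXind c
  set K := Real.exp (-(c ^ 2 / 2 * volterraBracket H t)) with hK
  have hexp : Measurable fun y : ℝ => Real.exp (c * y) := by fun_prop
  have hGm : Measurable[F T] fun ω => ξ₀ t ω * Real.exp (c * X ω) * K :=
    (((hξ_meas t).mono (F.mono zero_le) le_rfl).mul (hexp.comp hXm)).mul_const K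
  have hVW : V t =ᵐ[μ] fun ω => (ξ₀ t ω * Real.exp (c * X ω) * K) * Real.exp (c * W ω) := by
    filter_upwards [hV t, hVe] with ω h1 h2
    rw [h1, stochasticExp, h2, sub_eq_add_neg, mul_add, Real.exp_add, Real.exp_add]
    ring
  refine (condExp_congr_ae hVW).trans ((condExp_mul_exp (F.le T) hGm (hGi.mul_const K)
    (hWm.mono (F.le t) le_rfl) hWlaw hWind c).trans ?_)
  filter_upwards [hXe] with ω hω
  have hnn : 0 ≤ ((t : ℝ) - T) ^ (2 * H) / (2 * H) :=
    div_nonneg (Real.rpow_nonneg (sub_nonneg.2 (by exact_mod_cast hT)) _) (by positivity)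
  rw [eta, hω, setIntegral_kernel_sq hH hT, Real.coe_toNNReal _ hnn, mul_assoc _ K, hK,
    volterraBracket_eq hH, ← Real.exp_add]
  -- The exponents match because `c ^ 2 / 2 = 2 * ν ^ 2 * cH H ^ 2`, which divided by `2 * H` gives
  -- the factor `ν ^ 2 * cH H ^ 2 / H`.
  congr 2
  rw [hc]
  field_simp
  ring

lemma stronglyMeasurable_integral_toNNReal {Ω : Type*} [MeasurableSpace Ω] {f : ℝ≥0 → Ω → ℝ}
    (hf : Measurable (Function.uncurry f)) (ρ : Measure ℝ) [SFinite ρ] :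
    StronglyMeasurable fun ω => ∫ u, f u.toNNReal ω ∂ρ := by
  have h : Measurable fun p : Ω × ℝ => f p.2.toNNReal p.1 :=
    hf.comp ((measurable_real_toNNReal.comp measurable_snd).prodMk measurable_fst)
  exact h.stronglyMeasurable.integral_prod_right

/-- Joint integrability of a nonnegative, jointly measurable process with integrable means. -/
lemma integrable_prod_of_nonneg {X : ℝ≥0 → Ω → ℝ} (hX : Measurable (Function.uncurry X))
    {T t : ℝ≥0} (hint : ∀ u, T ≤ u → Integrable (X u) μ)
    (hpos : ∀ u, T ≤ u → 0 ≤ᵐ[μ] X u) {g : ℝ → ℝ}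
    (hg : IntegrableOn g (Set.Ioc (T : ℝ) t) volume)
    (hXg : ∀ u : ℝ, (T : ℝ) ≤ u → ∫ ω, X u.toNNReal ω ∂μ = g u) :
    Integrable (fun p : ℝ × Ω => X p.1.toNNReal p.2)
      ((volume.restrict (Set.Ioc (T : ℝ) t)).prod μ) := by
  have hm : Measurable fun p : ℝ × Ω => X p.1.toNNReal p.2 :=
    hX.comp ((measurable_real_toNNReal.comp measurable_fst).prodMk measurable_snd)
  have hle : ∀ u : ℝ, (T : ℝ) ≤ u → T ≤ u.toNNReal := fun u hu => NNReal.le_toNNReal_of_coe_le hu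
  rw [integrable_prod_iff hm.aestronglyMeasurable]
  constructor
  · filter_upwards [ae_restrict_mem measurableSet_Ioc] with u hu using hint _ (hle u hu.1.le)
  -- By nonnegativity the `L¹` norm of each time slice is its mean `g u`.
  · refine hg.congr ?_
    filter_upwards [ae_restrict_mem measurableSet_Ioc] with u hu
    rw [← hXg u hu.1.le]
    refine integral_congr_ae ?_
    filter_upwards [hpos _ (hle u hu.1.le)] with ω hω
    exact (Real.norm_of_nonneg hω).symm

/-- The variance swap strikes are obtained by integrating the forward variance over maturities. -/
theorem varianceSwapStrike_ae_eq {T t : ℝ≥0} (hTt : T < t) {ξT : ℝ≥0 → Ω → ℝ}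
    (hξT : Measurable[@Prod.instMeasurableSpace ℝ≥0 Ω inferInstance (F T)] (Function.uncurry ξT))
    (hξTV : ∀ u, T ≤ u → ξT u =ᵐ[μ] forwardVariance μ F V T u)
    (hVint : ∀ u, T ≤ u → Integrable (V u) μ)
    (hVi : Integrable (fun p : ℝ × Ω => V p.1.toNNReal p.2)
      ((volume.restrict (Set.Ioc (T : ℝ) t)).prod μ))
    (hξi : Integrable (fun p : ℝ × Ω => ξT p.1.toNNReal p.2)
      ((volume.restrict (Set.Ioc (T : ℝ) t)).prod μ)) :
    varianceSwapStrike μ F V T t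
      =ᵐ[μ] fun ω => ((t : ℝ) - T)⁻¹ * ∫ u in (T : ℝ)..t, ξT u.toNNReal ω := by
  have hle : (T : ℝ) ≤ t := by exact_mod_cast hTt.le
  unfold varianceSwapStrike
  simp only [intervalIntegral.integral_of_le hle]
  -- The candidate is tested on events `A` of `F T`: after Fubini, for each fixed `u` the integrals
  -- over `A` agree by the defining property of `E[V_u | F T]`.
  refine (ae_eq_condExp_of_forall_setIntegral_eq (F.le T) (hVi.integral_prod_right.const_mul _)
    (fun A _ _ => (hξi.integral_prod_right.const_mul _).integrableOn) (fun A hA _ => ?_) ?_).symm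
  · have hr : ∀ {Y : ℝ × Ω → ℝ}, Integrable Y ((volume.restrict (Set.Ioc (T : ℝ) t)).prod μ) →
        Integrable Y ((volume.restrict (Set.Ioc (T : ℝ) t)).prod (μ.restrict A)) := fun hY =>
      hY.mono_measure (Measure.prod_mono le_rfl Measure.restrict_le_self)
    rw [integral_const_mul, integral_const_mul]
    congr 1
    rw [← integral_integral_swap (f := fun (u : ℝ) ω => ξT u.toNNReal ω) (hr hξi),
      ← integral_integral_swap (f := fun (u : ℝ) ω => V u.toNNReal ω) (hr hVi)]
    refine setIntegral_congr_fun measurableSet_Ioc fun u hu => ?_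
    have hu' : T ≤ u.toNNReal := NNReal.le_toNNReal_of_coe_le hu.1.le
    change ∫ ω in A, ξT u.toNNReal ω ∂μ = ∫ ω in A, V u.toNNReal ω ∂μ
    rw [← setIntegral_condExp (F.le T) (hVint _ hu') hA]
    exact setIntegral_congr_ae (F.le T _ hA) ((hξTV _ hu').mono fun ω h _ => h)
  -- The σ-algebra on `Ω` is `F T` here: joint measurability of `ξT` with respect to it makes the
  -- integral over maturities `F T`-measurable.
  · exact ((@stronglyMeasurable_integral_toNNReal Ω (F T) ξT hξT _ _).const_mul
      _).aestronglyMeasurable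

end Variance

end RoughBergomi

open RoughBergomi in
theorem proposition3p2 {Ω : Type*} {mΩ : MeasurableSpace Ω} (μ : Measure Ω)
    [IsProbabilityMeasure μ] (F : Filtration ℝ≥0 mΩ) (Z : ℝ≥0 → Ω → ℝ)
    (hZ : RoughBergomi.IsFilteredBrownian Z F μ)
    (H ν : ℝ) (hH0 : 0 < H) (hH1 : H < 1) (hν : 0 < ν)
    (ξ₀ : ℝ≥0 → Ω → ℝ) (hξ_pos : ∀ t ω, 0 < ξ₀ t ω)
    (hξ_meas : ∀ t, Measurable[F 0] (ξ₀ t)) (hξ_int : ∀ t, Integrable (ξ₀ t) μ)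
    (V : ℝ≥0 → Ω → ℝ) (hV : RoughBergomi.IsInstantaneousVariance μ Z H ν ξ₀ V) :
    -- the representation of `ξ_T(t) = E[V_t | F_T]`
    (∀ T t : ℝ≥0, T ≤ t → Integrable (V t) μ ∧
      RoughBergomi.forwardVariance μ F V T t =ᵐ[μ] fun ω =>
        ξ₀ t ω * RoughBergomi.eta μ Z H ν T t ω *
          Real.exp (ν ^ 2 * RoughBergomi.cH H ^ 2 / H *
            (((t : ℝ) - T) ^ (2 * H) - (t : ℝ) ^ (2 * H)))) ∧
    -- the same curve, integrated over maturities, gives the variance swap strikes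
    (Measurable (Function.uncurry V) →
      ∀ (T : ℝ≥0) (ξT : ℝ≥0 → Ω → ℝ),
      Measurable[@Prod.instMeasurableSpace ℝ≥0 Ω inferInstance (F T)] (Function.uncurry ξT) →
      (∀ t, T ≤ t → ξT t =ᵐ[μ] fun ω =>
        ξ₀ t ω * RoughBergomi.eta μ Z H ν T t ω *
          Real.exp (ν ^ 2 * RoughBergomi.cH H ^ 2 / H *
            (((t : ℝ) - T) ^ (2 * H) - (t : ℝ) ^ (2 * H)))) →
      ∀ t : ℝ≥0, T < t →
        IntervalIntegrable (fun u : ℝ => ∫ ω, ξ₀ u.toNNReal ω ∂μ) volume (T : ℝ) (t : ℝ) →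
        Integrable (fun p : ℝ × Ω => V p.1.toNNReal p.2)
          ((volume.restrict (Set.Ioc (T : ℝ) (t : ℝ))).prod μ) ∧
        RoughBergomi.varianceSwapStrike μ F V T t =ᵐ[μ] fun ω =>
          ((t : ℝ) - T)⁻¹ * ∫ u in (T : ℝ)..t, ξT u.toNNReal ω) := by
  have hVI := hV.integrable_and_integral hZ hH0 hξ_meas hξ_int
  have hfwd := fun {T t : ℝ≥0} (h : T ≤ t) => hV.forwardVariance_ae_eq hZ hH0 hξ_meas hξ_int h
  refine ⟨fun T t hT => ⟨(hVI t).1, hfwd hT⟩, fun hVm T ξT hξTm hξT t hTt hmean => ?_⟩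
  have hle : ∀ u : ℝ, (T : ℝ) ≤ u → T ≤ u.toNNReal := fun u hu => NNReal.le_toNNReal_of_coe_le hu
  have hξTV : ∀ u, T ≤ u → ξT u =ᵐ[μ] forwardVariance μ F V T u := fun u hu =>
    (hξT u hu).trans (hfwd hu).symm
  have hVi := integrable_prod_of_nonneg hVm (fun u _ => (hVI u).1)
    (fun u _ => (hV u).mono fun ω h => by
      rw [h]; exact mul_nonneg (hξ_pos u ω).le (Real.exp_pos _).le) hmean.1
    (fun u _ => (hVI u.toNNReal).2)
  have hξTm' : Measurable (Function.uncurry ξT) :=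
    hξTm.mono (sup_le_sup le_rfl (MeasurableSpace.comap_mono (F.le T))) le_rfl
  have hξi := integrable_prod_of_nonneg hξTm'
    (fun u hu => integrable_condExp.congr (hξTV u hu).symm)
    (fun u hu => (hξT u hu).mono fun ω h => by
      rw [h]
      exact mul_nonneg (mul_nonneg (hξ_pos u ω).le (Real.exp_pos _).le) (Real.exp_pos _).le)
    -- Conditioning preserves the mean, so `ξT u` has the same mean as `V u`, namely that of `ξ₀ u`.
    hmean.1 (fun u hu => by
      rw [integral_congr_ae (hξTV _ (hle u hu)), forwardVariance, integral_condExp (F.le T)]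
      exact (hVI u.toNNReal).2)
  exact ⟨hVi, varianceSwapStrike_ae_eq hTt hξTm hξTV (fun u _ => (hVI u).1) hVi hξi⟩
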